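/- Let $G$ be a group and let $M \subseteq G$ be a submonoid, with group of units $M^\times$. Order the set $P = M^\times\backslash G$ of classes $[g] = M^\times g$ by $[g] \geq [h]$ if and only if $g = mh$ for some $m \in M$, and let $X_P$ be the set $P$ with the Alexandrov topology, whose open sets are the upwards closed subsets. The group $G$ acts on $X_P$ from the right by $[x]\cdot g = [xg]$. Let $\widehat{X_P}$ be (the underlying set of) the sobrification of $X_P$, that is, the set of irreducible closed subsets of $X_P$, with the induced right $G$-action. Then the isomorphism classes of points of the topos $M\text{-}\mathsf{Sets}$ of left $M$-sets, i.e. of geometric morphisms $\mathsf{Sets} \to M\text{-}\mathsf{Sets}$ up to natural isomorphism of their inverse image functors, are in bijection with the set-theoretic quotient $\widehat{X_P}/G$. The bijection can be chosen such that the orbit of $V \in \widehat{X_P}$ corresponds to the point whose inverse image functor sends an $M$-set $S$ to the quotient of $\{(g,s) : g \in G,\ [g] \in V,\ s \in S\}$ by the equivalence relation generated by $(g,s) \sim (mg, ms)$ for $m \in M$ with $[mg] \in V$ (the stalk at $V$ of the $G$-equivariant sheaf on $X_P$ corresponding to $S$). -/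

import Mathlib

open CategoryTheory CategoryTheory.Limits TopologicalSpace
open scoped Pointwise

universe u

section Topos

universe v₁ v₂ u₁ u₂

/-- A geometric morphism `F ⟶ E`: a direct image functor together with a left adjoint
(the inverse image functor) that preserves finite limits. -/
structure GeometricMorphism (F : Type u₁) [Category.{v₁} F] (E : Type u₂) [Category.{v₂} E] where
  /-- the direct image functor `f_*` -/
  direct : F ⥤ E
  /-- the inverse image functor `f^*` -/
  inverse : E ⥤ F
  /-- the adjunction `f^* ⊣ f_*` -/
  adj : inverse ⊣ direct
  /-- the inverse image functor is left exact -/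
  lex : PreservesFiniteLimits inverse

/-- A point of a topos `E` is a geometric morphism from the topos of sets to `E`. -/
abbrev ToposPoint (E : Type u₂) [Category.{v₂} E] := GeometricMorphism (Type u) E

/-- Two geometric morphisms are isomorphic when their inverse image functors are naturally
isomorphic (2-cells between geometric morphisms are natural transformations between the
inverse image functors). -/
def geometricMorphismSetoid (F : Type u₁) [Category.{v₁} F] (E : Type u₂) [Category.{v₂} E] :
    Setoid (GeometricMorphism F E) where
  r p q := Nonempty (p.inverse ≅ q.inverse)
  iseqv :=
    { refl := fun p => ⟨Iso.refl p.inverse⟩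
      symm := fun ⟨α⟩ => ⟨α.symm⟩
      trans := fun ⟨α⟩ ⟨β⟩ => ⟨α.trans β⟩ }

/-- The isomorphism classes of points of a topos `E`. -/
abbrev ToposPointClasses (E : Type u₂) [Category.{v₂} E] :=
  Quotient (geometricMorphismSetoid (Type u) E)

end Topos

/-- The topos of (left) `M`-sets and `M`-equivariant maps. -/
abbrev MSets (M : Type u) [Monoid M] := Action (Type u) M

section Sobrification

/-- The underlying set of the sobrification of `X`: the irreducible closed subsets of `X`. -/
abbrev Sobrification (X : Type u) [TopologicalSpace X] := IrreducibleCloseds X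

/-- An action of a group by homeomorphisms on `X` induces an action on the sobrification,
sending an irreducible closed subset to its image. -/
instance Sobrification.mulAction {H X : Type u} [Group H] [TopologicalSpace X] [MulAction H X]
    [ContinuousConstSMul H X] : MulAction H (IrreducibleCloseds X) where
  smul h V :=
    { carrier := h • (V : Set X)
      isIrreducible' := V.isIrreducible.image (fun x => h • x) (continuous_const_smul h).continuousOn
      isClosed' := V.isClosed.smul h }
  one_smul V := IrreducibleCloseds.ext (one_smul H (V : Set X))
  mul_smul g h V := IrreducibleCloseds.ext (mul_smul g h (V : Set X))

end Sobrification

section Cosets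

variable {G : Type u} [Group G] (M : Submonoid G)

/-- The set `M^× \ G` of orbits of the unit group of `M`, acting on `G` by left
multiplication. -/
def UnitCosets : Type u := MulAction.orbitRel.Quotient (↥M)ˣ G

namespace UnitCosets

variable {M}

/-- The class `[g]` of `g`. -/
def mk (M : Submonoid G) (g : G) : UnitCosets M :=
  Quotient.mk (MulAction.orbitRel (↥M)ˣ G) g

theorem mk_eq_iff {g h : G} : mk M g = mk M h ↔ ∃ w : (↥M)ˣ, ((w : M) : G) * h = g :=
  Quotient.eq (r := MulAction.orbitRel (↥M)ˣ G)

theorem ind {p : UnitCosets M → Prop} (h : ∀ g, p (mk M g)) (x : UnitCosets M) : p x :=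
  Quotient.ind h x

/-- `[g] ≥ [h]` if and only if `g = m h` for some `m ∈ M`. -/
protected def le (x y : UnitCosets M) : Prop :=
  ∃ h g : G, mk M h = x ∧ mk M g = y ∧ ∃ m : M, g = m * h

instance : LE (UnitCosets M) := ⟨UnitCosets.le⟩

theorem mk_le_mk {h g : G} : mk M h ≤ mk M g ↔ ∃ m : M, g = m * h := by
  constructor
  · rintro ⟨h', g', hh, hg, m, rfl⟩
    obtain ⟨a, rfl⟩ := mk_eq_iff.1 hh
    obtain ⟨b, hb⟩ := mk_eq_iff.1 hg.symm
    refine ⟨b * m * a, ?_⟩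
    rw [← hb]
    push_cast
    simp only [mul_assoc]
  · rintro ⟨m, rfl⟩
    exact ⟨h, _, rfl, rfl, m, rfl⟩

instance : PartialOrder (UnitCosets M) where
  le_refl := ind fun g => mk_le_mk.2 ⟨1, by simp⟩
  le_trans := ind fun a => ind fun b => ind fun c => by
    rw [mk_le_mk, mk_le_mk, mk_le_mk]
    rintro ⟨m, rfl⟩ ⟨n, rfl⟩
    exact ⟨n * m, by simp [mul_assoc]⟩
  le_antisymm := ind fun a => ind fun b => by
    rw [mk_le_mk, mk_le_mk, mk_eq_iff]
    rintro ⟨m, rfl⟩ ⟨n, hn⟩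
    have h1 : (n : G) * m = 1 := by
      have : ((n : G) * m) * a = 1 * a := by rw [mul_assoc, one_mul]; exact hn.symm
      exact mul_right_cancel this
    have h2 : (m : G) * n = 1 := mul_eq_one_comm.1 h1
    exact ⟨⟨n, m, Subtype.ext h1, Subtype.ext h2⟩, hn.symm⟩

/-- The Alexandrov topology: the open sets are the upwards closed sets. With this topology,
`UnitCosets M` is the space `X_P`. -/
instance : TopologicalSpace (UnitCosets M) := Topology.upperSet (UnitCosets M)

instance : Topology.IsUpperSet (UnitCosets M) := ⟨rfl⟩

/-- The right action of `G` by right multiplication: `[x] · g = [x g]`. -/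
instance : MulAction Gᵐᵒᵖ (UnitCosets M) where
  smul g := Quotient.map (fun x : G => x * g.unop) (by
    rintro _ y ⟨w, rfl⟩
    exact ⟨w, (mul_assoc _ _ _).symm⟩)
  one_smul := ind fun x => congrArg (mk M) (mul_one x)
  mul_smul g h := ind fun x => congrArg (mk M) (mul_assoc x h.unop g.unop).symm

theorem op_smul_mk (g x : G) : MulOpposite.op g • mk M x = mk M (x * g) := rfl

theorem smul_mono (g : Gᵐᵒᵖ) : Monotone fun x : UnitCosets M => g • x := by
  refine ind fun a => ind fun b => fun hab => ?_
  obtain ⟨m, rfl⟩ := mk_le_mk.1 hab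
  exact mk_le_mk.2 ⟨m, mul_assoc _ _ _⟩

instance : ContinuousConstSMul Gᵐᵒᵖ (UnitCosets M) :=
  ⟨fun g => Topology.IsUpperSet.monotone_iff_continuous.1 (smul_mono g)⟩

end UnitCosets

end Cosets

section Stalk

variable {G : Type u} [Group G] {M : Submonoid G}

/-- An `M`-set `S` gives a `G`-equivariant sheaf on `X_P` whose stalk at `[g]` is a copy of `S`,
for each representative `g`, the restriction from `[g]` to `[m g] ≥ [g]` being
multiplication by `m`. Its stalk at the point `V` of the sobrification is the colimit of these
stalks over the directed set `V`: the set of pairs `(g, s)` with `[g] ∈ V` and `s ∈ S`, modulo the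
equivalence relation generated by `(g, s) ∼ (m g, m s)`, which is `StalkRel`. -/
inductive StalkRel (V : Sobrification (UnitCosets M)) (S : MSets M) :
    {g : G // UnitCosets.mk M g ∈ V} × S.V → {g : G // UnitCosets.mk M g ∈ V} × S.V → Prop
  | restrict (m : M) (g : G) (hg : UnitCosets.mk M g ∈ V)
      (hmg : UnitCosets.mk M (m * g) ∈ V) (s : S.V) :
      StalkRel V S (⟨g, hg⟩, s) (⟨m * g, hmg⟩, S.ρ m s)

/-- The functor sending an `M`-set to the stalk at `V` of the corresponding equivariant sheaf. -/
def stalkFunctor (V : Sobrification (UnitCosets M)) : MSets M ⥤ Type u where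
  obj S := Quot (StalkRel V S)
  map {S T} f := TypeCat.ofHom (Quot.map (fun x => (x.1, f.hom x.2)) (by
    rintro _ _ ⟨m, g, hg, hmg, s⟩
    have : f.hom (S.ρ m s) = T.ρ m (f.hom s) := by
      have := congrArg (fun k => k s) (f.comm m)
      simpa using this
    simp only [this]
    exact StalkRel.restrict m g hg hmg _))
  map_id S := by
    ext x
    induction x using Quot.ind
    rfl
  map_comp f g := by
    ext x
    induction x using Quot.ind
    rfl

end Stalk

/-! A left exact left adjoint `F` to sets is determined by the right `M`-set `A = F M`, its value at
the regular `M`-set: `F S` consists of classes `a ⊗ s`. Exactness makes `A` filtering: it is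
nonempty, two elements are multiples of a third, and `a m = a n` forces `k m = k n` for some `k`,
hence `m = n` inside the group. So `A` embeds equivariantly in `G`: fix `a₀`, write `a₀ = b x` and
`a = b y`, and send `a` to `x⁻¹ y`. The inverses of the image form a directed lower set `V` in `M^×
\ G`, that is, an irreducible closed set, and `F` is the stalk functor at `V`. Conversely, a stalk
is a filtered colimit of copies of `S`, hence left exact. Two equivariant embeddings of `A` differ
by a left translation of `G`, which moves `V` within its orbit.

The notion carrying this is `IsCoordinate`; existence is `exists_isCoordinate`, uniqueness
`exists_eq_op_smul`, reconstruction of `F` `nonempty_iso`. -/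

namespace MSets

variable {M : Type u} [Monoid M]

theorem ρ_one_apply (S : MSets M) (s : S.V) : S.ρ 1 s = s := by
  rw [map_one]; rfl

theorem ρ_mul_apply (S : MSets M) (m n : M) (s : S.V) : S.ρ (m * n) s = S.ρ m (S.ρ n s) := by
  rw [map_mul]; rfl

theorem hom_ρ {S T : MSets M} (f : S ⟶ T) (m : M) (s : S.V) :
    f.hom (S.ρ m s) = T.ρ m (f.hom s) :=
  ConcreteCategory.congr_hom (f.comm m) s

/-- The equivariant map from the regular `M`-set to `S` sending `1` to `s`. -/
def orbitMap (S : MSets M) (s : S.V) : Action.leftRegular M ⟶ S where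
  hom := TypeCat.ofHom fun n : M => S.ρ n s
  comm m := by
    ext n
    exact ρ_mul_apply S m n s

theorem orbitMap_hom_one (S : MSets M) (s : S.V) : (orbitMap S s).hom (1 : M) = s :=
  ρ_one_apply S s

theorem orbitMap_comp {S T : MSets M} (s : S.V) (f : S ⟶ T) :
    orbitMap S s ≫ f = orbitMap T (f.hom s) := by
  ext n
  exact hom_ρ f n s

theorem orbitMap_comp_orbitMap (S : MSets M) (m : M) (s : S.V) :
    orbitMap (Action.leftRegular M) m ≫ orbitMap S s = orbitMap S (S.ρ m s) :=
  orbitMap_comp (S := Action.leftRegular M) m _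

/-! ### Functors on `M`-sets and the right `M`-set `F M` -/

variable (F : MSets M ⥤ Type u)

/-- The right translation by `m` on the value of `F` at the regular `M`-set. -/
def rightMul (a : F.obj (Action.leftRegular M)) (m : M) : F.obj (Action.leftRegular M) :=
  F.map (orbitMap (Action.leftRegular M) m) a

theorem map_orbitMap_rightMul (S : MSets M) (a : F.obj (Action.leftRegular M)) (m : M) (s : S.V) :
    F.map (orbitMap S s) (rightMul F a m) = F.map (orbitMap S (S.ρ m s)) a := by
  rw [← orbitMap_comp_orbitMap, F.map_comp]; rfl

theorem map_orbitMap_naturality {S T : MSets M} (f : S ⟶ T) (s : S.V)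
    (a : F.obj (Action.leftRegular M)) :
    F.map f (F.map (orbitMap S s) a) = F.map (orbitMap T (f.hom s)) a := by
  rw [← orbitMap_comp, F.map_comp]; rfl

theorem rightMul_mul (a : F.obj (Action.leftRegular M)) (m n : M) :
    rightMul F a (m * n) = rightMul F (rightMul F a m) n :=
  (map_orbitMap_rightMul F (Action.leftRegular M) a m n).symm

variable {F}

/-- A left adjoint functor is generated by its value at the regular `M`-set. -/
theorem exists_map_orbitMap_eq {R : Type u ⥤ MSets M} (adj : F ⊣ R) {S : MSets M} (z : F.obj S) :
    ∃ (s : S.V) (a : F.obj (Action.leftRegular M)), F.map (orbitMap S s) a = z := by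
  -- Compare the constant predicate with "is generated": their adjuncts are maps out of `S`, so
  -- agreement can be tested along each `orbitMap S s`, where both hold.
  let p : F.obj S ⟶ ULift.{u} Prop := TypeCat.ofHom fun _ => ⟨True⟩
  let q : F.obj S ⟶ ULift.{u} Prop :=
    TypeCat.ofHom fun z => ⟨∃ (s : S.V) (a : F.obj (Action.leftRegular M)),
      F.map (orbitMap S s) a = z⟩
  have hpq : p = q := by
    apply (adj.homEquiv _ _).injective
    ext s
    have key : orbitMap S s ≫ adj.homEquiv _ _ p = orbitMap S s ≫ adj.homEquiv _ _ q := by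
      rw [← adj.homEquiv_naturality_left, ← adj.homEquiv_naturality_left]
      congr 1
      ext a
      exact ⟨fun _ => ⟨s, a, rfl⟩, fun _ => trivial⟩
    have := ConcreteCategory.congr_hom (congrArg Action.Hom.hom key) (1 : M)
    change (adj.homEquiv _ _ p).hom ((orbitMap S s).hom (1 : M)) =
      (adj.homEquiv _ _ q).hom ((orbitMap S s).hom (1 : M)) at this
    rwa [orbitMap_hom_one] at this
  have := congrArg ULift.down (ConcreteCategory.congr_hom hpq z)
  exact this.mp trivial

section Lex

variable [PreservesFiniteLimits F]

theorem nonempty_obj_leftRegular {R : Type u ⥤ MSets M} (adj : F ⊣ R) :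
    Nonempty (F.obj (Action.leftRegular M)) := by
  let z : F.obj (⊤_ MSets M) :=
    (terminal.from PUnit.{u + 1} ≫ (PreservesTerminal.iso F).inv) PUnit.unit
  obtain ⟨_, a, -⟩ := exists_map_orbitMap_eq adj z
  exact ⟨a⟩

/-- `F` preserves the product `S ⨯ T`, so `(a, b)` is an element of `F (S ⨯ T)`, which is itself
generated from `F M`. -/
theorem exists_map_orbitMap_eq_and {R : Type u ⥤ MSets M} (adj : F ⊣ R) {S T : MSets M}
    (a : F.obj S) (b : F.obj T) :
    ∃ (s : S.V) (t : T.V) (c : F.obj (Action.leftRegular M)),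
      F.map (orbitMap S s) c = a ∧ F.map (orbitMap T t) c = b := by
  have h := mapIsLimitOfPreservesOfIsLimit F _ _ (prodIsProd S T)
  obtain ⟨l, hl, hr⟩ := BinaryFan.IsLimit.lift' h (TypeCat.ofHom fun _ : PUnit => a)
    (TypeCat.ofHom fun _ : PUnit => b)
  obtain ⟨p, c, hc⟩ := exists_map_orbitMap_eq adj (l PUnit.unit)
  refine ⟨(prod.fst : S ⨯ T ⟶ S).hom p, (prod.snd : S ⨯ T ⟶ T).hom p, c, ?_, ?_⟩
  · rw [← map_orbitMap_naturality, hc]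
    exact ConcreteCategory.congr_hom hl PUnit.unit
  · rw [← map_orbitMap_naturality, hc]
    exact ConcreteCategory.congr_hom hr PUnit.unit

/-- `F` preserves the equalizer of `f` and `g`, so `a` comes from it; a generator there supplies
`s`. -/
theorem exists_map_orbitMap_eq_of_map_eq {R : Type u ⥤ MSets M} (adj : F ⊣ R) {S T : MSets M}
    {f g : S ⟶ T} {a : F.obj S} (h : F.map f a = F.map g a) :
    ∃ (s : S.V) (c : F.obj (Action.leftRegular M)),
      f.hom s = g.hom s ∧ F.map (orbitMap S s) c = a := by
  obtain ⟨z, hz, -⟩ := Types.unique_of_type_equalizer _ _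
    (isLimitForkMapOfIsLimit F (equalizer.condition f g) (equalizerIsEqualizer f g)) a h
  obtain ⟨s, c, hc⟩ := exists_map_orbitMap_eq adj z
  refine ⟨(equalizer.ι f g).hom s, c, ?_, ?_⟩
  · exact ConcreteCategory.congr_hom (congrArg Action.Hom.hom (equalizer.condition f g)) s
  · rw [← map_orbitMap_naturality, hc, hz]

/-- Any two elements of the value at the regular `M`-set are right multiples of a third one. -/
theorem exists_rightMul_eq_and {R : Type u ⥤ MSets M} (adj : F ⊣ R)
    (a b : F.obj (Action.leftRegular M)) :
    ∃ (m n : M) (c : F.obj (Action.leftRegular M)), rightMul F c m = a ∧ rightMul F c n = b :=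
  exists_map_orbitMap_eq_and adj a b

theorem exists_of_rightMul_eq {R : Type u ⥤ MSets M} (adj : F ⊣ R)
    {a : F.obj (Action.leftRegular M)} {m n : M} (h : rightMul F a m = rightMul F a n) :
    ∃ k : M, k * m = k * n := by
  obtain ⟨k, -, hk, -⟩ := exists_map_orbitMap_eq_of_map_eq adj h
  exact ⟨k, hk⟩

/-- Elements `(a, s)` and `(b, t)` with the same image in `F S` are identified by passing to
a common left multiple. -/
theorem exists_of_map_orbitMap_eq {R : Type u ⥤ MSets M} (adj : F ⊣ R) {S : MSets M}
    {a b : F.obj (Action.leftRegular M)} {s t : S.V}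
    (h : F.map (orbitMap S s) a = F.map (orbitMap S t) b) :
    ∃ (m n : M) (c : F.obj (Action.leftRegular M)),
      rightMul F c m = a ∧ rightMul F c n = b ∧ S.ρ m s = S.ρ n t := by
  obtain ⟨x, y, c, rfl, rfl⟩ := exists_rightMul_eq_and adj a b
  rw [map_orbitMap_rightMul, map_orbitMap_rightMul] at h
  -- Over the common element `c`, the equalizer lies in the regular `M`-set, so its element is some
  -- `k : M` equalizing `x s` and `y t`.
  obtain ⟨(k : M), d, hk, rfl⟩ := exists_map_orbitMap_eq_of_map_eq adj h
  refine ⟨k * x, k * y, d, rightMul_mul F d k x, rightMul_mul F d k y, ?_⟩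
  rw [ρ_mul_apply, ρ_mul_apply]
  exact hk

end Lex

end MSets

/-! ### Irreducible closed sets as directed lower sets -/

namespace UnitCosets

variable {G : Type u} [Group G] {M : Submonoid G}

theorem exists_mk_mem (V : Sobrification (UnitCosets M)) : ∃ g : G, mk M g ∈ V := by
  obtain ⟨x, hx⟩ := V.isIrreducible.nonempty
  induction x using ind with
  | h g => exact ⟨g, hx⟩

theorem mem_of_le {V : Sobrification (UnitCosets M)} {x y : UnitCosets M} (h : x ≤ y)
    (hy : y ∈ V) : x ∈ V :=
  Topology.IsUpperSet.isClosed_iff_isLower.1 V.isClosed h hy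

theorem mk_mem_of_mk_mul_mem {V : Sobrification (UnitCosets M)} {m : M} {g : G}
    (h : mk M (m * g) ∈ V) : mk M g ∈ V :=
  mem_of_le (mk_le_mk.2 ⟨m, rfl⟩) h

/-- Division by `m` stays in `V`, while multiplication may leave it; hence `M` acts on coinduced
functions through `g ↦ m⁻¹ g`. -/
theorem mk_inv_mul_mem {V : Sobrification (UnitCosets M)} (m : M) {g : G}
    (h : mk M g ∈ V) : mk M ((m : G)⁻¹ * g) ∈ V :=
  mk_mem_of_mk_mul_mem (m := m) (by rwa [mul_inv_cancel_left])

theorem exists_le_and_le {V : Sobrification (UnitCosets M)} {g h : G} (hg : mk M g ∈ V)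
    (hh : mk M h ∈ V) : ∃ k : G, mk M k ∈ V ∧ mk M g ≤ mk M k ∧ mk M h ≤ mk M k := by
  obtain ⟨z, hz, hgz, hhz⟩ := V.isIrreducible.2 (Set.Ici (mk M g)) (Set.Ici (mk M h))
    (Topology.IsUpperSet.isOpen_iff_isUpperSet.2 (isUpperSet_Ici _))
    (Topology.IsUpperSet.isOpen_iff_isUpperSet.2 (isUpperSet_Ici _))
    ⟨_, hg, Set.self_mem_Ici⟩ ⟨_, hh, Set.self_mem_Ici⟩
  induction z using ind with
  | h k => exact ⟨k, hz, hgz, hhz⟩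

theorem mk_mem_op_smul {V : Sobrification (UnitCosets M)} {k g : G} :
    mk M g ∈ MulOpposite.op k • V ↔ mk M (g * k⁻¹) ∈ V :=
  Set.mem_smul_set_iff_inv_smul_mem

theorem sobrification_ext {V W : Sobrification (UnitCosets M)}
    (h : ∀ g : G, mk M g ∈ V ↔ mk M g ∈ W) : V = W :=
  SetLike.ext (ind h)

/-- Directed lower sets are irreducible and closed for the Alexandrov topology. -/
def ofDirected (s : Set (UnitCosets M)) (hne : s.Nonempty) (hs : IsLowerSet s)
    (hd : DirectedOn (· ≤ ·) s) : Sobrification (UnitCosets M) where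
  carrier := s
  isIrreducible' := by
    refine ⟨hne, ?_⟩
    rintro u v hu hv ⟨x, hxs, hxu⟩ ⟨y, hys, hyv⟩
    rw [Topology.IsUpperSet.isOpen_iff_isUpperSet] at hu hv
    obtain ⟨z, hzs, hxz, hyz⟩ := hd x hxs y hys
    exact ⟨z, hzs, hu hxz hxu, hv hyz hyv⟩
  isClosed' := Topology.IsUpperSet.isClosed_iff_isLower.2 hs

end UnitCosets

/-! ### Stalks as filtered colimits, and their right adjoints -/

section Representatives

variable {G : Type u} [Group G] {M : Submonoid G}

/-- The group elements whose class lies in `V`, preordered by divisibility by elements of `M`. -/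
def Representatives (V : Sobrification (UnitCosets M)) : Type u :=
  {g : G // UnitCosets.mk M g ∈ V}

variable (V : Sobrification (UnitCosets M))

instance : Preorder (Representatives V) := Preorder.lift fun g => UnitCosets.mk M g.1

instance : Nonempty (Representatives V) :=
  let ⟨g, hg⟩ := UnitCosets.exists_mk_mem V
  ⟨⟨g, hg⟩⟩

instance : IsDirectedOrder (Representatives V) where
  directed g h :=
    let ⟨k, hk, hgk, hhk⟩ := UnitCosets.exists_le_and_le g.2 h.2
    ⟨⟨k, hk⟩, hgk, hhk⟩

variable {V}

/-- The element of `M` carrying `g` to `h` when `[g] ≤ [h]`. -/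
def Representatives.quotient {g h : Representatives V} (hgh : g ≤ h) : M :=
  ⟨h.1 * g.1⁻¹, by
    obtain ⟨m, hm⟩ := UnitCosets.mk_le_mk.1 hgh
    rw [hm, mul_inv_cancel_right]
    exact m.2⟩

theorem Representatives.quotient_mul {g h : Representatives V} (hgh : g ≤ h) :
    (quotient hgh : G) * g.1 = h.1 :=
  inv_mul_cancel_right _ _

variable (V)

/-- The diagram of stalks of the equivariant sheaf attached to an `M`-set. -/
def stalkDiagram : MSets M ⥤ Representatives V ⥤ Type u where
  obj S :=
    { obj := fun _ => S.V
      map := fun f => S.ρ (Representatives.quotient (leOfHom f))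
      map_id := fun g => by
        have : Representatives.quotient (leOfHom (𝟙 g)) = 1 :=
          Subtype.ext (mul_inv_cancel _)
        rw [this, map_one]
        rfl
      map_comp := fun {a b c} f g => by
        have : Representatives.quotient (leOfHom (f ≫ g)) =
            Representatives.quotient (leOfHom g) * Representatives.quotient (leOfHom f) :=
          Subtype.ext (by simp [Representatives.quotient])
        rw [this, map_mul]
        rfl }
  map f :=
    { app := fun _ => f.hom
      naturality := fun _ _ _ => f.comm _ }

instance : PreservesFiniteLimits (stalkDiagram V) :=
  preservesFiniteLimits_of_evaluation _ fun _ =>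
    preservesFiniteLimits_of_natIso (F := Action.forget (Type u) M)
      (NatIso.ofComponents fun _ => Iso.refl _)

variable {V}

/-- The germ at `V` of an element of the stalk at `[g]`. -/
def germ {S : MSets M} (g : G) (hg : UnitCosets.mk M g ∈ V) (s : S.V) : (stalkFunctor V).obj S :=
  Quot.mk _ (⟨g, hg⟩, s)

theorem germ_mul {S : MSets M} {m : M} {g : G} (hg : UnitCosets.mk M g ∈ V)
    (h : UnitCosets.mk M (m * g) ∈ V) (s : S.V) :
    germ (m * g) h (S.ρ m s) = germ g hg s :=
  (Quot.sound (StalkRel.restrict m g _ _ s)).symm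

theorem germ_inv_mul {S : MSets M} (m : M) {g : G} (hg : UnitCosets.mk M g ∈ V) (s : S.V) :
    germ ((m : G)⁻¹ * g) (UnitCosets.mk_inv_mul_mem m hg) s = germ g hg (S.ρ m s) := by
  rw [← germ_mul (m := m) _ (by rwa [mul_inv_cancel_left])]
  congr 1
  exact mul_inv_cancel_left _ _

theorem germ_eq_germ {S : MSets M} {m n : M} {g h : G} {hg : UnitCosets.mk M g ∈ V}
    {hh : UnitCosets.mk M h ∈ V} {s t : S.V} (hmg : UnitCosets.mk M (m * g) ∈ V)
    (hgh : (m : G) * g = n * h) (hst : S.ρ m s = S.ρ n t) : germ g hg s = germ h hh t := by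
  rw [← germ_mul hg hmg, ← germ_mul (m := n) hh (hgh ▸ hmg), hst]
  congr 1

theorem germ_ind {S : MSets M} {p : (stalkFunctor V).obj S → Prop}
    (h : ∀ g hg s, p (germ g hg s)) (x : (stalkFunctor V).obj S) : p x :=
  Quot.ind (fun x => h x.1.1 x.1.2 x.2) x

variable (V)

/-- The stalk as a cocone under the diagram of stalks. -/
def stalkCocone (S : MSets M) : Cocone ((stalkDiagram V).obj S) where
  pt := (stalkFunctor V).obj S
  ι :=
    { app := fun g => TypeCat.ofHom fun s : S.V => germ g.1 g.2 s
      naturality := fun g h f => by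
        ext s
        have e := Representatives.quotient_mul (leOfHom f)
        have := germ_mul (S := S) (m := Representatives.quotient (leOfHom f)) g.2
          (e.symm ▸ h.2) s
        refine Eq.trans ?_ this
        change germ h.1 h.2 (S.ρ (Representatives.quotient (leOfHom f)) s) = _
        congr 1
        exact e.symm }

/-- The stalk is the colimit of the diagram of stalks. -/
def stalkCoconeIsColimit (S : MSets M) : IsColimit (stalkCocone V S) where
  desc c := TypeCat.ofHom (Quot.lift (fun x => c.ι.app x.1 x.2) (by
    rintro _ _ ⟨m, g, hg, hmg, s⟩
    let a : Representatives V := ⟨g, hg⟩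
    let b : Representatives V := ⟨m * g, hmg⟩
    let f : a ⟶ b := homOfLE (UnitCosets.mk_le_mk.2 ⟨m, rfl⟩)
    have hm : Representatives.quotient (leOfHom f) = m :=
      Subtype.ext (mul_inv_cancel_right (m : G) g)
    have := ConcreteCategory.congr_hom (c.w f) s
    change c.ι.app _ (S.ρ (Representatives.quotient (leOfHom f)) s) = _ at this
    rw [hm] at this
    exact this.symm))
  fac c g := rfl
  uniq c f hf := by
    ext x
    induction x using Quot.ind with
    | mk x => exact ConcreteCategory.congr_hom (hf x.1) x.2

/-- The stalk functor is a filtered colimit of forgetful functors. -/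
noncomputable def stalkFunctorIso : stalkDiagram V ⋙ colim ≅ stalkFunctor V :=
  NatIso.ofComponents
    (fun S => colimit.isoColimitCocone ⟨stalkCocone V S, stalkCoconeIsColimit V S⟩)
    (fun {S T} f => by
      refine colimit.hom_ext fun g => ?_
      have hS := colimit.isoColimitCocone_ι_hom ⟨stalkCocone V S, stalkCoconeIsColimit V S⟩ g
      have hT := colimit.isoColimitCocone_ι_hom ⟨stalkCocone V T, stalkCoconeIsColimit V T⟩ g
      refine (congrArg (· ≫ (colimit.isoColimitCocone
        ⟨stalkCocone V T, stalkCoconeIsColimit V T⟩).hom)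
        (ι_colimMap ((stalkDiagram V).map f) g)).trans ?_
      exact (congrArg (((stalkDiagram V).map f).app g ≫ ·) hT).trans
        (congrArg (· ≫ (stalkFunctor V).map f) hS).symm)

/-- Finite limits commute with colimits over the directed preorder `Representatives V`. -/
instance : PreservesFiniteLimits (stalkFunctor V) :=
  preservesFiniteLimits_of_natIso (stalkFunctorIso V)

/-- The right adjoint of the stalk functor at `V`. -/
def stalkCoinduction : Type u ⥤ MSets M where
  obj T :=
    { V := Representatives V → T
      ρ :=
        { toFun := fun m => TypeCat.ofHom fun φ g =>
            φ ⟨(m : G)⁻¹ * g.1, UnitCosets.mk_inv_mul_mem m g.2⟩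
          map_one' := by
            refine ConcreteCategory.hom_ext _ _ fun φ => funext fun g => ?_
            exact congrArg φ (Subtype.ext (by simp))
          map_mul' := fun m n => by
            refine ConcreteCategory.hom_ext _ _ fun φ => funext fun g => ?_
            exact congrArg φ (Subtype.ext (by simp [mul_assoc])) } }
  map f :=
    { hom := TypeCat.ofHom fun φ g => f (φ g)
      comm := fun _ => rfl }

/-- The stalk functor is left adjoint to coinduction. -/
def stalkAdjunction : stalkFunctor V ⊣ stalkCoinduction V :=
  Adjunction.mkOfHomEquiv
    { homEquiv := fun S T =>
        { toFun := fun f =>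
            { hom := TypeCat.ofHom fun s g => f (germ g.1 g.2 s)
              comm := fun m => by
                ext s
                funext g
                exact congrArg f (germ_inv_mul m g.2 s).symm }
          invFun := fun f => TypeCat.ofHom (Quot.lift (fun x => f.hom x.2 x.1) (by
            rintro _ _ ⟨m, g, hg, hmg, s⟩
            change f.hom s _ = f.hom (S.ρ m s) _
            rw [MSets.hom_ρ]
            exact congrArg (f.hom s) (Subtype.ext (inv_mul_cancel_left _ _).symm)))
          left_inv := fun f => by
            ext x
            induction x using Quot.ind
            rfl
          right_inv := fun f => rfl }
      homEquiv_naturality_left_symm := fun f g => by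
        ext x
        induction x using Quot.ind
        rfl
      homEquiv_naturality_right := fun f g => rfl }

/-- The point of the topos of `M`-sets given by the stalk at `V`. -/
def stalkPoint : ToposPoint.{u} (MSets M) where
  direct := stalkCoinduction V
  inverse := stalkFunctor V
  adj := stalkAdjunction V
  lex := inferInstance

end Representatives

/-! ### Embeddings of `F M` into `G` -/

section Coordinates

variable {G : Type u} [Group G] {M : Submonoid G}

/-- An equivariant embedding into `G` of the right `M`-set `F M`, with image the inverses of the
representatives of the elements of `V`. -/
structure IsCoordinate (F : MSets M ⥤ Type u) (V : Sobrification (UnitCosets M))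
    (c : F.obj (Action.leftRegular M) → G) : Prop where
  injective : Function.Injective c
  map_rightMul (a : F.obj (Action.leftRegular M)) (m : M) : c (MSets.rightMul F a m) = c a * m
  mk_mem_iff (g : G) : UnitCosets.mk M g ∈ V ↔ ∃ a, c a = g⁻¹

namespace IsCoordinate

variable {F F' : MSets M ⥤ Type u} {V W : Sobrification (UnitCosets M)}
  {c d : F.obj (Action.leftRegular M) → G}

theorem comp_iso (hc : IsCoordinate F V c) (α : F' ≅ F) :
    IsCoordinate F' V fun a => c (α.hom.app _ a) where
  injective := hc.injective.comp ((isIso_iff_bijective (α.hom.app _)).1 inferInstance).1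
  map_rightMul a m := by
    rw [← hc.map_rightMul]
    exact congrArg c (ConcreteCategory.congr_hom (α.hom.naturality _) a)
  mk_mem_iff g := by
    rw [hc.mk_mem_iff]
    exact (((isIso_iff_bijective (α.hom.app _)).1 inferInstance).2.exists
      (p := fun a => c a = g⁻¹))

/-- Inversion turns left translation of the image into right translation of `V`. -/
theorem op_smul (hc : IsCoordinate F V c) (k : G) :
    IsCoordinate F (MulOpposite.op k • V) fun a => k⁻¹ * c a where
  injective := (mul_right_injective k⁻¹).comp hc.injective
  map_rightMul a m := by rw [hc.map_rightMul, mul_assoc]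
  mk_mem_iff g := by
    rw [UnitCosets.mk_mem_op_smul, hc.mk_mem_iff]
    refine exists_congr fun a => ?_
    rw [mul_inv_rev, inv_inv, inv_mul_eq_iff_eq_mul]

variable [PreservesFiniteLimits F] {R : Type u ⥤ MSets M}

/-- Two coordinates on the same functor differ by a translation. -/
theorem exists_eq_op_smul (adj : F ⊣ R) (hc : IsCoordinate F V c) (hd : IsCoordinate F W d) :
    ∃ k : G, W = MulOpposite.op k • V := by
  obtain ⟨a₀⟩ := MSets.nonempty_obj_leftRegular adj
  -- If `a₀ = b m` and `a = b n`, both ratios `d a₀ (c a₀)⁻¹` and `d a (c a)⁻¹` equal `d b (c b)⁻¹`.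
  have key : ∀ a, d a = d a₀ * (c a₀)⁻¹ * c a := fun a => by
    obtain ⟨m, n, b, rfl, rfl⟩ := MSets.exists_rightMul_eq_and adj a₀ a
    simp only [hc.map_rightMul, hd.map_rightMul]
    group
  refine ⟨(d a₀ * (c a₀)⁻¹)⁻¹, UnitCosets.sobrification_ext fun g => ?_⟩
  rw [(hc.op_smul _).mk_mem_iff, hd.mk_mem_iff]
  exact exists_congr fun a => by rw [inv_inv, key a]

/-- A left exact left adjoint with coordinates is the stalk functor. -/
theorem nonempty_iso (adj : F ⊣ R) (hc : IsCoordinate F V c) :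
    Nonempty (F ≅ stalkFunctor V) := by
  choose r hr using fun g : {g : G // UnitCosets.mk M g ∈ V} => (hc.mk_mem_iff g).1 g.2
  have hr_mul (m : M) (g : G) (hg : UnitCosets.mk M g ∈ V) (hmg : UnitCosets.mk M (m * g) ∈ V) :
      MSets.rightMul F (r ⟨m * g, hmg⟩) m = r ⟨g, hg⟩ := by
    apply hc.injective
    rw [hc.map_rightMul, hr, hr, mul_inv_rev, inv_mul_cancel_right]
  -- The comparison sends the germ of `s` at `g` to `r g ⊗ s`, where `r g` has coordinate `g⁻¹`.
  let f (S : MSets M) : (stalkFunctor V).obj S ⟶ F.obj S :=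
    TypeCat.ofHom (Quot.lift (fun x => F.map (MSets.orbitMap S x.2) (r x.1)) (by
      rintro _ _ ⟨m, g, hg, hmg, s⟩
      change F.map (MSets.orbitMap S s) (r ⟨g, hg⟩) =
        F.map (MSets.orbitMap S (S.ρ m s)) (r ⟨m * g, hmg⟩)
      rw [← MSets.map_orbitMap_rightMul, hr_mul m g hg hmg]))
  have f_germ (S : MSets M) (g : G) (hg : UnitCosets.mk M g ∈ V) (s : S.V) :
      f S (germ g hg s) = F.map (MSets.orbitMap S s) (r ⟨g, hg⟩) := rfl
  have hf (S : MSets M) : IsIso (f S) := by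
    rw [isIso_iff_bijective]
    constructor
    · refine germ_ind fun g hg s => germ_ind fun h hh t => ?_
      rw [f_germ, f_germ]
      intro e
      obtain ⟨m, n, b, hm, hn, hst⟩ := MSets.exists_of_map_orbitMap_eq adj e
      -- A common divisor `b` in `F M` becomes the common left multiple `(c b)⁻¹` of `g` and `h`,
      -- where the two germs agree.
      have mul_eq {p : M} {l : G} (hl : UnitCosets.mk M l ∈ V)
          (hp : MSets.rightMul F b p = r ⟨l, hl⟩) : (p : G) * l = (c b)⁻¹ := by
        have := congrArg c hp
        rw [hc.map_rightMul, hr] at this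
        rw [eq_inv_iff_mul_eq_one, ← mul_eq_one_comm, ← mul_assoc, this, inv_mul_cancel]
      have hm' := mul_eq hg hm
      have hn' := mul_eq hh hn
      have hb : UnitCosets.mk M (c b)⁻¹ ∈ V := (hc.mk_mem_iff _).2 ⟨b, (inv_inv _).symm⟩
      exact germ_eq_germ (hm'.symm ▸ hb) (hm'.trans hn'.symm) hst
    · intro z
      obtain ⟨s, a, rfl⟩ := MSets.exists_map_orbitMap_eq adj z
      have ha : UnitCosets.mk M (c a)⁻¹ ∈ V := (hc.mk_mem_iff _).2 ⟨a, (inv_inv _).symm⟩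
      refine ⟨germ _ ha s, ?_⟩
      rw [f_germ]
      congr 1
      exact hc.injective ((hr _).trans (inv_inv _))
  refine ⟨(NatIso.ofComponents (fun S => asIso (f S)) fun {S T} φ => ?_).symm⟩
  ext x
  induction x using germ_ind with
  | h g hg s => exact (MSets.map_orbitMap_naturality F φ s _).symm

end IsCoordinate

/-- The canonical coordinates `[(g, m)] ↦ g⁻¹ m` of the stalk functor. -/
theorem exists_isCoordinate_stalkFunctor (V : Sobrification (UnitCosets M)) :
    ∃ c, IsCoordinate (stalkFunctor V) V c := by
  let c : (stalkFunctor V).obj (Action.leftRegular M) → G :=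
    Quot.lift (fun x => x.1.1⁻¹ * (show M from x.2 : M)) (by
      rintro _ _ ⟨m, g, hg, hmg, (n : M)⟩
      change g⁻¹ * (n : G) = (m * g)⁻¹ * ((m * n : M) : G)
      push_cast
      group)
  have c_germ (g : G) (hg : UnitCosets.mk M g ∈ V) (n : M) :
      c (germ (S := Action.leftRegular M) g hg n) = g⁻¹ * n := rfl
  refine ⟨c, ?_, ?_, ?_⟩
  · refine germ_ind fun g hg (m : M) => germ_ind fun h hh (n : M) => ?_
    rw [c_germ, c_germ]
    intro e
    -- With `k = x g = y h`, the equality `g⁻¹ m = h⁻¹ n` gives `x m = y n`, so the germs agree at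
    -- `k`.
    obtain ⟨k, hk, hgk, hhk⟩ := UnitCosets.exists_le_and_le hg hh
    obtain ⟨x, rfl⟩ := UnitCosets.mk_le_mk.1 hgk
    obtain ⟨y, hy⟩ := UnitCosets.mk_le_mk.1 hhk
    refine germ_eq_germ (S := Action.leftRegular M) hk hy ?_
    change x * m = y * n
    apply Subtype.ext
    push_cast
    have hx : (x : G) = y * h * g⁻¹ := eq_mul_inv_of_mul_eq hy
    rw [hx, mul_assoc, e]
    group
  · refine germ_ind fun g hg (n : M) m => ?_
    change g⁻¹ * ((n * m : M) : G) = g⁻¹ * n * m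
    push_cast
    rw [mul_assoc]
  · intro g
    constructor
    · intro hg
      refine ⟨germ (S := Action.leftRegular M) g hg (1 : M), ?_⟩
      rw [c_germ, OneMemClass.coe_one, mul_one]
    · rintro ⟨a, ha⟩
      induction a using germ_ind with
      | h h hh n =>
        change h⁻¹ * ((show M from n : M) : G) = g⁻¹ at ha
        refine UnitCosets.mk_mem_of_mk_mul_mem (m := (show M from n : M)) ?_
        have : ((show M from n : M) : G) * g = h := by
          rw [inv_mul_eq_iff_eq_mul.1 ha, inv_mul_cancel_right]
        rwa [this]

/-- Every left exact left adjoint functor to sets has coordinates. -/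
theorem exists_isCoordinate {F : MSets M ⥤ Type u} [PreservesFiniteLimits F]
    {R : Type u ⥤ MSets M} (adj : F ⊣ R) : ∃ V c, IsCoordinate F V c := by
  obtain ⟨a₀⟩ := MSets.nonempty_obj_leftRegular adj
  choose x y b hx hy using MSets.exists_rightMul_eq_and adj a₀
  have cancel {a : F.obj (Action.leftRegular M)} {m n : M}
      (h : MSets.rightMul F a m = MSets.rightMul F a n) : m = n := by
    obtain ⟨k, hk⟩ := MSets.exists_of_rightMul_eq adj h
    exact mul_left_cancel hk
  let c (a : F.obj (Action.leftRegular M)) : G := (x a : G)⁻¹ * y a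
  -- The quotient is independent of the chosen divisor: two divisors of `a₀` and `a` are multiples
  -- of one `e`, and cancellation at `e` compares them.
  have hc {a d : F.obj (Action.leftRegular M)} {m n : M} (hm : MSets.rightMul F d m = a₀)
      (hn : MSets.rightMul F d n = a) : c a = (m : G)⁻¹ * n := by
    obtain ⟨p, q, e, hp, hq⟩ := MSets.exists_rightMul_eq_and adj d (b a)
    have h1 : p * m = q * x a := cancel (a := e) (by
      rw [MSets.rightMul_mul, MSets.rightMul_mul, hp, hq, hm, hx])
    have h2 : p * n = q * y a := cancel (a := e) (by
      rw [MSets.rightMul_mul, MSets.rightMul_mul, hp, hq, hn, hy])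
    have h1' : (p : G) * m = q * x a := congrArg Subtype.val h1
    have h2' : (p : G) * n = q * y a := congrArg Subtype.val h2
    have : (m : G)⁻¹ * n = ((p : G) * m)⁻¹ * (p * n) := by group
    rw [this, h1', h2']
    change (x a : G)⁻¹ * y a = _
    group
  have c_rightMul (a : F.obj (Action.leftRegular M)) (m : M) :
      c (MSets.rightMul F a m) = c a * m := by
    rw [hc (hx a) ((MSets.rightMul_mul F (b a) (y a) m).trans (by rw [hy]))]
    exact (mul_assoc _ _ _).symm
  have c_inj : Function.Injective c := fun a d h => by
    obtain ⟨p, q, e, rfl, rfl⟩ := MSets.exists_rightMul_eq_and adj a d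
    rw [c_rightMul, c_rightMul] at h
    rw [Subtype.ext (mul_left_cancel h)]
  -- The set of inverses is stable under left multiplication by units, so membership can be tested
  -- on any representative.
  have mem (g : G) : UnitCosets.mk M g ∈ UnitCosets.mk M '' {g | ∃ a, c a = g⁻¹} ↔
      ∃ a, c a = g⁻¹ := by
    refine ⟨?_, fun h => ⟨g, h, rfl⟩⟩
    rintro ⟨h, ⟨a, ha⟩, e⟩
    obtain ⟨w, rfl⟩ := UnitCosets.mk_eq_iff.1 e
    refine ⟨MSets.rightMul F a w, ?_⟩
    rw [c_rightMul, ha]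
    group
  refine ⟨UnitCosets.ofDirected (UnitCosets.mk M '' {g | ∃ a, c a = g⁻¹}) ?_ ?_ ?_, c,
    c_inj, c_rightMul, mem⟩
  · exact ⟨_, (c a₀)⁻¹, ⟨a₀, (inv_inv _).symm⟩, rfl⟩
  · refine UnitCosets.ind fun g => UnitCosets.ind fun h => fun hle => ?_
    rw [mem, mem]
    rintro ⟨a, ha⟩
    obtain ⟨m, rfl⟩ := UnitCosets.mk_le_mk.1 hle
    refine ⟨MSets.rightMul F a m, ?_⟩
    rw [c_rightMul, ha]
    group
  · rintro _ ⟨g, ⟨a, ha⟩, rfl⟩ _ ⟨h, ⟨d, hd⟩, rfl⟩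
    obtain ⟨p, q, e, rfl, rfl⟩ := MSets.exists_rightMul_eq_and adj a d
    rw [c_rightMul] at ha hd
    refine ⟨UnitCosets.mk M (c e)⁻¹, ⟨_, ⟨e, (inv_inv _).symm⟩, rfl⟩,
      UnitCosets.mk_le_mk.2 ⟨p, ?_⟩, UnitCosets.mk_le_mk.2 ⟨q, ?_⟩⟩
    · rw [← inv_inv g, ← ha]
      group
    · rw [← inv_inv h, ← hd]
      group

end Coordinates

/-- For a submonoid `M` of a group `G`, the orbits of `G` on the sobrification of the Alexandrov
space `M^× \ G` are in bijection with the isomorphism classes of points of the topos of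
`M`-sets; the class of `V` corresponds to the point whose inverse image functor is the
stalk at `V`. -/
theorem corollary3 {G : Type u} [Group G] (M : Submonoid G) :
    ∃ e : MulAction.orbitRel.Quotient Gᵐᵒᵖ (Sobrification (UnitCosets M)) ≃
        ToposPointClasses.{u} (MSets M),
      ∀ (V : Sobrification (UnitCosets M)) (p : ToposPoint.{u} (MSets M)),
        e (Quotient.mk (MulAction.orbitRel Gᵐᵒᵖ (Sobrification (UnitCosets M))) V) =
            Quotient.mk (geometricMorphismSetoid (Type u) (MSets M)) p ↔
          Nonempty (p.inverse ≅ stalkFunctor V) := by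
  let f : MulAction.orbitRel.Quotient Gᵐᵒᵖ (Sobrification (UnitCosets M)) →
      ToposPointClasses.{u} (MSets M) :=
    Quotient.lift (fun V => Quotient.mk _ (stalkPoint V)) (by
      rintro _ V ⟨k, rfl⟩
      obtain ⟨c, hc⟩ := exists_isCoordinate_stalkFunctor V
      obtain ⟨α⟩ := (hc.op_smul k.unop).nonempty_iso (stalkAdjunction V)
      exact Quotient.sound ⟨α.symm⟩)
  have hf (V : Sobrification (UnitCosets M)) (p : ToposPoint.{u} (MSets M)) :
      f (Quotient.mk _ V) = Quotient.mk (geometricMorphismSetoid (Type u) (MSets M)) p ↔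
        Nonempty (p.inverse ≅ stalkFunctor V) := by
    refine Quotient.eq.trans ⟨?_, ?_⟩
    · rintro ⟨α⟩
      exact ⟨α.symm⟩
    · rintro ⟨α⟩
      exact ⟨α.symm⟩
  refine ⟨Equiv.ofBijective f ⟨?_, ?_⟩, hf⟩
  · intro x y
    induction x using Quotient.ind with | _ V
    induction y using Quotient.ind with | _ W
    intro h
    obtain ⟨α⟩ := (hf V (stalkPoint W)).1 h
    obtain ⟨c, hc⟩ := exists_isCoordinate_stalkFunctor V
    obtain ⟨d, hd⟩ := exists_isCoordinate_stalkFunctor W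
    -- Transport along `α` puts the coordinates for `V` and for `W` on the same functor.
    obtain ⟨k, hk⟩ := hd.exists_eq_op_smul (stalkAdjunction W) (hc.comp_iso α)
    exact Quotient.sound ⟨MulOpposite.op k, hk.symm⟩
  · intro x
    induction x using Quotient.ind with | _ p
    have := p.lex
    obtain ⟨V, c, hc⟩ := exists_isCoordinate p.adj
    exact ⟨Quotient.mk _ V, (hf V p).2 (hc.nonempty_iso p.adj)⟩
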